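/- Let $\mathcal M=(S,A,T,R,\gamma,\eta_0)$ be a Markov decision process with measurable state space $S$, measurable action space $A$, transition kernel $T(s,a,\cdot)$, measurable reward $R(s,a)\in[0,1]$, discount factor $\gamma\in[0,1)$ and initial distribution $\eta_0$. Let $\tilde S$ be a finite set of nonempty, pairwise disjoint, measurable *subgoal regions* $\tilde s\subseteq S$, with union $\bar S$, and suppose that $\eta_0$ gives probability $0$ to $S\setminus\tilde s_0$ for some $\tilde s_0\in\tilde S$. Let $\mathcal O$ be a finite set of *subgoal transitions*, i.e. options $o=(\pi,\tilde s,\beta)$ consisting of a measurable policy $\pi:S\to A$, an initial region $\tilde s\in\tilde S$ in whose states $o$ may be started, and the termination rule $\beta(s)=\mathbf 1(s\in\bar S\setminus\tilde s)$, checked after each step; assume that the set $\mathcal O(\tilde s)$ of options in $\mathcal O$ with initial region $\tilde s$ is nonempty for every $\tilde s\in\tilde S$. For $s\in S$ and $o=(\pi,\tilde s,\beta)\in\mathcal O$ run $\pi$ from $s_0=s$ and let $\tau\in\{1,2,\dots\}\cup\{\infty\}$ be the time at which $o$ terminates. Put $$R_{\rm opt}(s,o)=\mathbb E\Big[\sum_{0\le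 k<\tau}\gamma^kR(s_k,\pi(s_k))\Big],\qquad T_{\rm opt}(s,o,B)=\sum_{t\ge1}\gamma^t\,\mathbb P(\tau=t,\ s_t\in B),\qquad \tilde T(s,o,\tilde s')=\sum_{t\ge1}\gamma^t\,\mathbb P(\tau=t,\ s_t\in\tilde s').$$ For $\tilde s,\tilde s'\in\tilde S$ and $o\in\mathcal O(\tilde s)$ let $\tilde T_{\inf}(\tilde s,o,\tilde s')$ and $\tilde T_{\sup}(\tilde s,o,\tilde s')$ be the infimum and supremum of $\tilde T(s,o,\tilde s')$ over $s\in\tilde s$, and let $\tilde R_{\inf}(\tilde s,o)$ and $\tilde R_{\sup}(\tilde s,o)$ be those of $R_{\rm opt}(s,o)$. Let $$\varepsilon_T=\max_{\tilde s,\tilde s'\in\tilde S,\ o\in\mathcal O(\tilde s)}\big(\tilde T_{\sup}-\tilde T_{\inf}\big)(\tilde s,o,\tilde s'),\qquad \varepsilon_R=\max_{\tilde s\in\tilde S,\ o\in\mathcal O(\tilde s)}\big(\tilde R_{\sup}-\tilde R_{\inf}\big)(\tilde s,o).$$ For $z\in\{\inf,\sup\}$ and $V:\tilde S\to\mathbb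 R$ put $$\tilde Q_z(V,\tilde s,o)=\tilde R_z(\tilde s,o)+\sum_{\tilde s'\in\tilde S}\tilde T_z(\tilde s,o,\tilde s')V(\tilde s'),\qquad \tilde F_z(V)(\tilde s)=\max_{o\in\mathcal O(\tilde s)}\tilde Q_z(V,\tilde s,o).$$ Robust abstract value iteration (R-AVI) iterates $\tilde F_{\inf}$ and $\tilde F_{\sup}$. An *option policy* $\rho$ assigns measurably to each $s\in\bar S$ an option $\rho(s)\in\mathcal O$ whose initial region contains $s$. It induces a policy $\pi_\rho$ with memory for $\mathcal M$: start the option $\rho(s_0)$, follow the current option until it terminates, in a state $s'$ say, then switch to the option $\rho(s')$, and so on. $J(\pi_\rho)$ is the expected discounted total reward $\mathbb E[\sum_{t\ge0}\gamma^tR(s_t,a_t)]$ of $\pi_\rho$ with $s_0\sim\eta_0$. An optimal option policy $\rho^*$ is one with $\rho^*(s)\in\arg\max_{o}Q^*(s,o)$ for all $s\in\bar S$, where, with $o$ ranging over the options of $\mathcal O$ that can be started in $s$, $V^*(s)=\max_oQ^*(s,o)$ and $Q^*(s,o)=R_{\rm opt}(s,o)+\int V^*(s')\,T_{\rm opt}(s,o,ds')$,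 with $V^*$ bounded and measurable. **Theorem.** Assume $|\tilde S|\,\varepsilon_T<1-\gamma$. Then: 1. R-AVI converges: for $z\in\{\inf,\sup\}$ the operator $\tilde F_z$ is a contraction in the sup norm with constant $\gamma+|\tilde S|\varepsilon_T<1$; it has a unique fixed point $\tilde V_z^*$, and $\tilde F_z^n(V_0)\to\tilde V_z^*$ for every initial $V_0:\tilde S\to\mathbb R$. 2. Every conservative optimal option policy $\tilde\rho$, i.e. every option policy with $\tilde\rho(s)\in\arg\max_{o\in\mathcal O(\tilde s)}\tilde Q_{\inf}(\tilde V^*_{\inf},\tilde s,o)$ for all $\tilde s\in\tilde S$ and $s\in\tilde s$, satisfies, for every optimal option policy $\rho^*$, $$J(\pi_{\tilde\rho})\ \ge\ J(\pi_{\rho^*})-\frac{(1-\gamma)\varepsilon_R+|\tilde S|\varepsilon_T}{(1-\gamma)\big(1-(\gamma+|\tilde S|\varepsilon_T)\big)}.$$ -/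

import Mathlib

open MeasureTheory ProbabilityTheory Filter Topology

noncomputable section

namespace RAVI

/-- The law of the Markov chain with transition kernel `κ` started at `x`, a probability measure on
the trajectories `ω : ℕ → X`. -/
def chainLaw {X : Type*} [MeasurableSpace X] (κ : Kernel X X) [IsMarkovKernel κ] (x : X) :
    Measure (ℕ → X) :=
  Kernel.traj (X := fun _ : ℕ => X)
    (fun n => κ.comap (fun h : (i : Finset.Iic n) → X => h ⟨n, Finset.mem_Iic.2 le_rfl⟩)
      (measurable_pi_apply _)) 0 (fun _ => x)

/-- A discounted Markov decision process with state space `S` and action space `A`. -/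
structure MDP (S A : Type*) [MeasurableSpace S] [MeasurableSpace A] where
  /-- `T (s, a)` is the law of the next state. -/
  T : Kernel (S × A) S
  markov : IsMarkovKernel T
  R : S → A → ℝ
  measurable_R : Measurable fun p : S × A => R p.1 p.2
  R_nonneg : ∀ s a, 0 ≤ R s a
  R_le_one : ∀ s a, R s a ≤ 1
  γ : ℝ
  γ_nonneg : 0 ≤ γ
  γ_lt_one : γ < 1
  /-- The initial state distribution. -/
  η₀ : Measure S
  prob_η₀ : IsProbabilityMeasure η₀

attribute [instance] MDP.markov MDP.prob_η₀

/-- A family of disjoint nonempty subgoal regions, indexed by `ι`. -/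
structure SubgoalRegions (S ι : Type*) [MeasurableSpace S] where
  region : ι → Set S
  measurable : ∀ i, MeasurableSet (region i)
  nonempty : ∀ i, (region i).Nonempty
  disjoint : Pairwise fun i j => Disjoint (region i) (region j)

/-- The union of all subgoal regions. -/
def SubgoalRegions.union {S ι : Type*} [MeasurableSpace S] (D : SubgoalRegions S ι) : Set S :=
  ⋃ i, D.region i

/-- A subgoal transition: the option that uses `policy`, whose initial set is the subgoal region
with index `source`, and which terminates exactly upon entering another subgoal region
(see `SubgoalTransition.exitSet`). -/
structure SubgoalTransition (S A ι : Type*) [MeasurableSpace S] [MeasurableSpace A] where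
  policy : S → A
  measurable_policy : Measurable policy
  source : ι

instance {S A ι : Type*} [MeasurableSpace S] [MeasurableSpace A] :
    MeasurableSpace (SubgoalTransition S A ι) := ⊤

instance {S A ι : Type*} [MeasurableSpace S] [MeasurableSpace A] :
    DiscreteMeasurableSpace (SubgoalTransition S A ι) := ⟨fun _ => trivial⟩

section

variable {S A ι : Type*} [MeasurableSpace S] [MeasurableSpace A]

/-- The states in which the option terminates: its termination probability is the indicator
function of this set. -/
def SubgoalTransition.exitSet (D : SubgoalRegions S ι) (o : SubgoalTransition S A ι) : Set S :=
  D.union \ D.region o.source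

theorem SubgoalTransition.measurableSet_exitSet [Countable ι] (D : SubgoalRegions S ι)
    (o : SubgoalTransition S A ι) : MeasurableSet (o.exitSet D) :=
  (MeasurableSet.iUnion D.measurable).diff (D.measurable _)

/-- The state process of `M` when actions are chosen by the policy `o.policy`. -/
def policyKernel (M : MDP S A) (o : SubgoalTransition S A ι) : Kernel S S :=
  M.T.comap (fun s => (s, o.policy s)) (measurable_id.prodMk o.measurable_policy)

instance (M : MDP S A) (o : SubgoalTransition S A ι) : IsMarkovKernel (policyKernel M o) := by
  unfold policyKernel; infer_instance

/-- The law of the states visited when following the policy of `o` from `s`. -/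
def optionLaw (M : MDP S A) (o : SubgoalTransition S A ι) (s : S) : Measure (ℕ → S) :=
  chainLaw (policyKernel M o) s

/-- The time (at least `1`, possibly infinite) at which the option `o` terminates along the
trajectory `ω`. -/
def termTime (D : SubgoalRegions S ι) (o : SubgoalTransition S A ι) (ω : ℕ → S) : ℕ∞ :=
  sInf {n : ℕ∞ | ∃ t : ℕ, n = t ∧ 1 ≤ t ∧ ω t ∈ o.exitSet D}

/-- The measure `T_opt(s, o, ·) = ∑_{t ≥ 1} γ ^ t P(o terminates after t steps, in ·)`. -/
def optT (M : MDP S A) (D : SubgoalRegions S ι) (s : S) (o : SubgoalTransition S A ι) :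
    Measure S :=
  Measure.sum fun t : ℕ => ENNReal.ofReal (M.γ ^ (t + 1)) •
    ((optionLaw M o s).restrict {ω | termTime D o ω = ((t + 1 : ℕ) : ℕ∞)}).map
      (fun ω => ω (t + 1))

open Classical in
/-- The expected discounted reward collected by `o` from `s` before it terminates. -/
def optR (M : MDP S A) (D : SubgoalRegions S ι) (s : S) (o : SubgoalTransition S A ι) : ℝ :=
  ∫ ω, ∑' k : ℕ, (if (k : ℕ∞) < termTime D o ω then M.γ ^ k * M.R (ω k) (o.policy (ω k)) else 0)
    ∂(optionLaw M o s)

/-- `P(region j, t ∣ s, o)`: the probability that `o`, started in `s`, terminates after `t` steps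
and in the region `j`. -/
def termProb (M : MDP S A) (D : SubgoalRegions S ι) (s : S) (o : SubgoalTransition S A ι)
    (j : ι) (t : ℕ) : ℝ :=
  (optionLaw M o s).real {ω | termTime D o ω = (t : ℕ∞) ∧ ω t ∈ D.region j}

/-- The time-discounted probability `T̃(s, o, region j)`. -/
def abstractT (M : MDP S A) (D : SubgoalRegions S ι) (s : S) (o : SubgoalTransition S A ι)
    (j : ι) : ℝ :=
  ∑' t : ℕ, M.γ ^ (t + 1) * termProb M D s o j (t + 1)

/-- The two kinds of abstract bounds. -/
inductive BoundKind
  | inf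
  | sup

/-- `T̃_inf` and `T̃_sup`. -/
def boundT (M : MDP S A) (D : SubgoalRegions S ι) (z : BoundKind) (i : ι)
    (o : SubgoalTransition S A ι) (j : ι) : ℝ :=
  match z with
  | .inf => ⨅ s : D.region i, abstractT M D s o j
  | .sup => ⨆ s : D.region i, abstractT M D s o j

/-- `R̃_inf` and `R̃_sup`. -/
def boundR (M : MDP S A) (D : SubgoalRegions S ι) (z : BoundKind) (i : ι)
    (o : SubgoalTransition S A ι) : ℝ :=
  match z with
  | .inf => ⨅ s : D.region i, optR M D s o
  | .sup => ⨆ s : D.region i, optR M D s o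

/-- The options of `O` that can be used in the region `i`. -/
abbrev Available (O : Finset (SubgoalTransition S A ι)) (i : ι) : Type _ :=
  {o : O // o.1.source = i}

/-- `ε_T`: the largest gap between `T̃_sup` and `T̃_inf`, over all regions `i`, `j` and all options
that can be used in `i`. -/
def epsT (M : MDP S A) (D : SubgoalRegions S ι) (O : Finset (SubgoalTransition S A ι)) : ℝ :=
  ⨆ p : (Σ i : ι, Available O i) × ι,
    (boundT M D .sup p.1.1 p.1.2.1.1 p.2 - boundT M D .inf p.1.1 p.1.2.1.1 p.2)

/-- `ε_R`: the largest gap between `R̃_sup` and `R̃_inf`. -/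
def epsR (M : MDP S A) (D : SubgoalRegions S ι) (O : Finset (SubgoalTransition S A ι)) : ℝ :=
  ⨆ p : Σ i : ι, Available O i,
    (boundR M D .sup p.1 p.2.1.1 - boundR M D .inf p.1 p.2.1.1)

/-- `Q̃_z(V, region i, o)`. -/
def abstractQ [Fintype ι] (M : MDP S A) (D : SubgoalRegions S ι) (z : BoundKind) (V : ι → ℝ)
    (i : ι) (o : SubgoalTransition S A ι) : ℝ :=
  boundR M D z i o + ∑ j, boundT M D z i o j * V j

/-- The abstract Bellman operator `F̃_z`; abstract value iteration iterates it. -/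
def abstractBellman [Fintype ι] (M : MDP S A) (D : SubgoalRegions S ι)
    (O : Finset (SubgoalTransition S A ι)) (z : BoundKind) (V : ι → ℝ) : ι → ℝ :=
  fun i => ⨆ o : Available O i, abstractQ M D z V i o.1.1

/-- A (deterministic) option policy with options in `O`. Options are chosen in subgoal regions
only; the value of `choose` at other states is irrelevant. -/
structure OptionPolicy (D : SubgoalRegions S ι) (O : Finset (SubgoalTransition S A ι)) where
  choose : S → O
  measurable_choose : Measurable choose
  source_choose : ∀ i, ∀ s ∈ D.region i, (choose s).1.source = i

/-- The concrete option value `Q(V, s, o)`. -/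
def concreteQ (M : MDP S A) (D : SubgoalRegions S ι) (V : S → ℝ) (s : S)
    (o : SubgoalTransition S A ι) : ℝ :=
  optR M D s o + ∫ s', V s' ∂(optT M D s o)

/-- `V` is a bounded measurable solution of the Bellman optimality equations for the options `O`.
(Values of `V` outside the subgoal regions play no role.) -/
structure IsOptimalValue (M : MDP S A) (D : SubgoalRegions S ι)
    (O : Finset (SubgoalTransition S A ι)) (V : S → ℝ) : Prop where
  measurable : Measurable V
  bounded : ∃ C, ∀ s, |V s| ≤ C
  bellman : ∀ i, ∀ s ∈ D.region i, V s = ⨆ o : Available O i, concreteQ M D V s o.1.1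

/-- `ρ` is an optimal option policy: greedy for the solution of the Bellman equations. -/
def IsOptimal (M : MDP S A) (D : SubgoalRegions S ι) {O : Finset (SubgoalTransition S A ι)}
    (ρ : OptionPolicy D O) : Prop :=
  ∃ V, IsOptimalValue M D O V ∧ ∀ i, ∀ s ∈ D.region i, ∀ o ∈ O, o.source = i →
    concreteQ M D V s o ≤ concreteQ M D V s (ρ.choose s).1

/-- `ρ` is a conservative optimal option policy: greedy for the solution of the recursive equations
with the lower bounds. -/
def IsConservative [Fintype ι] (M : MDP S A) (D : SubgoalRegions S ι)
    {O : Finset (SubgoalTransition S A ι)} (ρ : OptionPolicy D O) : Prop :=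
  ∃ V, abstractBellman M D O .inf V = V ∧ ∀ i, ∀ s ∈ D.region i, ∀ o ∈ O, o.source = i →
    abstractQ M D .inf V i o ≤ abstractQ M D .inf V i (ρ.choose s).1

open Classical in
/-- The update of the pair (current state, option in use), when the next state is `q.2`: the option
is kept until it terminates, and then `ρ` chooses the next one. -/
def OptionPolicy.update {D : SubgoalRegions S ι} {O : Finset (SubgoalTransition S A ι)}
    (ρ : OptionPolicy D O) (q : (S × O) × S) : S × O :=
  (q.2, if q.2 ∈ q.1.2.1.exitSet D then ρ.choose q.2 else q.1.2)

theorem measurable_of_option {X Y : Type*} [MeasurableSpace X] [MeasurableSpace Y]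
    {O : Finset (SubgoalTransition S A ι)} {f : X × O → Y}
    (h : ∀ o, Measurable fun x => f (x, o)) : Measurable f :=
  measurable_from_prod_countable_left h

theorem OptionPolicy.measurable_update [Countable ι] {D : SubgoalRegions S ι}
    {O : Finset (SubgoalTransition S A ι)} (ρ : OptionPolicy D O) : Measurable ρ.update := by
  classical
  have h : Measurable fun p : (S × S) × O => ρ.update ((p.1.1, p.2), p.1.2) := by
    refine measurable_of_option fun o => ?_
    refine measurable_snd.prodMk (Measurable.ite ?_ ?_ measurable_const)
    · exact measurable_snd (o.1.measurableSet_exitSet D)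
    · exact ρ.measurable_choose.comp measurable_snd
  exact h.comp (((measurable_fst.comp measurable_fst).prodMk measurable_snd).prodMk
    (measurable_snd.comp measurable_fst))

/-- One step of `M` when the action is chosen by the option in use. -/
def actKernel (M : MDP S A) (O : Finset (SubgoalTransition S A ι)) : Kernel (S × O) S :=
  M.T.comap (fun p => (p.1, p.2.1.policy p.1))
    (measurable_of_option fun o => measurable_id.prodMk o.1.measurable_policy)

instance (M : MDP S A) (O : Finset (SubgoalTransition S A ι)) :
    IsMarkovKernel (actKernel M O) := by
  unfold actKernel; infer_instance

/-- The transition kernel of the pair (current state, option in use) when the policy `π_ρ` induced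
by `ρ` acts on `M`. -/
def inducedKernel (M : MDP S A) {D : SubgoalRegions S ι} {O : Finset (SubgoalTransition S A ι)}
    (ρ : OptionPolicy D O) : Kernel (S × O) (S × O) :=
  (Kernel.id ×ₖ actKernel M O).map ρ.update

instance [Countable ι] (M : MDP S A) {D : SubgoalRegions S ι}
    {O : Finset (SubgoalTransition S A ι)} (ρ : OptionPolicy D O) :
    IsMarkovKernel (inducedKernel M ρ) :=
  Kernel.IsMarkovKernel.map _ ρ.measurable_update

/-- The value of `s` under the induced policy `π_ρ`: the expected discounted sum of all rewards. -/
def value [Countable ι] (M : MDP S A) {D : SubgoalRegions S ι}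
    {O : Finset (SubgoalTransition S A ι)} (ρ : OptionPolicy D O) (s : S) : ℝ :=
  ∫ ω, ∑' t : ℕ, M.γ ^ t * M.R (ω t).1 ((ω t).2.1.policy (ω t).1)
    ∂(chainLaw (inducedKernel M ρ) (s, ρ.choose s))

/-- The expected reward `J(π_ρ)`. -/
def J [Countable ι] (M : MDP S A) {D : SubgoalRegions S ι}
    {O : Finset (SubgoalTransition S A ι)} (ρ : OptionPolicy D O) : ℝ :=
  ∫ s, value M ρ s ∂M.η₀

end

end RAVI

end

noncomputable section

namespace RAVI

/-! Convergence is Banach's fixed point theorem. An option takes at least one step, so `optT` has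
total mass at most `γ`. The regions are disjoint, so each row of `T̃_inf` sums to at most `γ`. Each
entry of `T̃_sup` exceeds that of `T̃_inf` by at most `ε_T`, so its rows sum to at most `γ +
|S̃|ε_T`. Taking a maximum over options does not increase sup-norm distances.

For the loss bound, let `V` be the fixed point of the lower operator. It is nonnegative, so lower
bounds on transitions give lower bounds on returns, and `V` lies below the value of a conservative
policy on every region (`fixed_le_value`). In particular `V ≤ 1/(1-γ)`. Conversely, replacing true
rewards and transitions by the lower ones costs at most `ε_R + |S̃|ε_T/(1-γ)` per option, hence that
amount divided by `1-γ` in the long run, for the value of any option policy (`value_le_fixed_add`).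
Chaining the two inequalities gives a bound slightly sharper than the stated one.

Both comparisons rest on the Bellman equation of an option policy, `value_eq_concreteQ`, a
discounted strong Markov property at the termination time. It is obtained without stopping times:
the value satisfies a one-step equation, which `eq_tsum_of_one_step` unrolls along the law of the
chain killed on entering the exit set. -/

/-- The trajectories that avoid `E` at the times `1, …, n`. -/
def avoidSet {X : Type*} (E : Set X) (n : ℕ) : Set (ℕ → X) :=
  {ω | ∀ t, 1 ≤ t → t ≤ n → ω t ∉ E}

theorem avoidSet_zero {X : Type*} (E : Set X) : avoidSet E 0 = Set.univ := by
  ext ω; simp only [avoidSet, Set.mem_ofPred_eq, Set.mem_univ, iff_true]; intro t; omega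

theorem avoidSet_succ {X : Type*} (E : Set X) (n : ℕ) :
    avoidSet E (n + 1) = avoidSet E n ∩ {ω | ω (n + 1) ∈ Eᶜ} := by
  ext ω
  simp only [avoidSet, Set.mem_inter_iff, Set.mem_ofPred_eq, Set.mem_compl_iff]
  constructor
  · exact fun h => ⟨fun t h1 h2 => h t h1 (by omega), h _ (by omega) le_rfl⟩
  · rintro ⟨h, h'⟩ t h1 h2
    rcases Nat.lt_or_ge n t with h3 | h3
    · obtain rfl : t = n + 1 := by omega
      exact h'
    · exact h t h1 h3

theorem measurable_integral_kernel {X : Type*} [MeasurableSpace X] (κ : Kernel X X) {f : X → ℝ} (hf : Measurable f) :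
    Measurable fun x => ∫ y, f y ∂κ x :=
  hf.stronglyMeasurable.integral_kernel.measurable

/-! ### Markov chains killed on entering a set -/

section Chain

variable {X : Type*} [MeasurableSpace X] (κ : Kernel X X) [IsMarkovKernel κ]

instance (x : X) : IsProbabilityMeasure (chainLaw κ x) := by
  unfold chainLaw; infer_instance

/-- The law of the state at time `n` on the event that `E` was avoided at the times `1, …, n`. -/
def killedLaw (E : Set X) (x : X) (n : ℕ) : Measure X :=
  ((chainLaw κ x).restrict (avoidSet E n)).map fun ω => ω n

instance (E : Set X) (x : X) (n : ℕ) : IsFiniteMeasure (killedLaw κ E x n) := by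
  unfold killedLaw; infer_instance

theorem measurableSet_avoidSet {E : Set X} (hE : MeasurableSet E) (n : ℕ) :
    MeasurableSet (avoidSet E n) := by
  simp only [avoidSet, Set.ofPred_forall]
  exact .iInter fun t => .iInter fun _ => .iInter fun _ => (measurable_pi_apply t hE).compl

theorem chainLaw_map_zero (x : X) : (chainLaw κ x).map (fun ω => ω 0) = Measure.dirac x := by
  have h := Kernel.traj_map_frestrictLe_apply (X := fun _ : ℕ => X)
    (κ := fun n => κ.comap (fun h : (i : Finset.Iic n) → X => h ⟨n, Finset.mem_Iic.2 le_rfl⟩)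
      (measurable_pi_apply _)) 0 0 (fun _ => x)
  rw [Kernel.partialTraj_self, Kernel.id_apply] at h
  have hg : Measurable fun g : (i : Finset.Iic 0) → X => g ⟨0, Finset.mem_Iic.2 le_rfl⟩ :=
    measurable_pi_apply _
  have h2 := congrArg (Measure.map fun g : (i : Finset.Iic 0) → X =>
    g ⟨0, Finset.mem_Iic.2 le_rfl⟩) h
  rw [Measure.map_map hg (Preorder.measurable_frestrictLe 0)] at h2
  exact h2.trans (Measure.map_dirac' hg _)

/-- Avoiding `E` up to time `n` depends only on the coordinates up to `n`. The joint law of these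
and the next coordinate is a composition-product with the transition kernel, which is the Markov
property needed here. -/
theorem chainLaw_map_succ (E : Set X) (hE : MeasurableSet E) (x : X) (n : ℕ) :
    ((chainLaw κ x).restrict (avoidSet E n)).map (fun ω => ω (n + 1)) =
      κ ∘ₘ killedLaw κ E x n := by
  ext B hB
  let A : Set ((i : Finset.Iic n) → X) := {h | ∀ t : Finset.Iic n, 1 ≤ t.1 → h t ∉ E}
  have hA : MeasurableSet A := by
    simp only [A, Set.ofPred_forall]
    exact .iInter fun t => .iInter fun _ => (measurable_pi_apply t hE).compl
  have hAn : avoidSet E n = Preorder.frestrictLe (π := fun _ => X) n ⁻¹' A := by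
    ext ω
    simp only [avoidSet, A, Set.mem_ofPred_eq, Set.mem_preimage, Preorder.frestrictLe_apply]
    exact ⟨fun h t ht => h t.1 ht (Finset.mem_Iic.1 t.2),
      fun h t h1 h2 => h ⟨t, Finset.mem_Iic.2 h2⟩ h1⟩
  have h := Kernel.partialTraj_compProd_eq_map_traj (X := fun _ : ℕ => X)
    (κ := fun n => κ.comap (fun h : (i : Finset.Iic n) → X => h ⟨n, Finset.mem_Iic.2 le_rfl⟩)
      (measurable_pi_apply _)) (Nat.zero_le n) (x₀ := fun _ => x)
  have h2 := congrArg (fun m => m (A ×ˢ B)) h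
  beta_reduce at h2
  rw [Measure.map_apply ((Preorder.measurable_frestrictLe n).prodMk (measurable_pi_apply _))
    (hA.prod hB), Measure.compProd_apply_prod hA hB, ← Kernel.traj_map_frestrictLe_apply,
    setLIntegral_map hA (Kernel.measurable_coe _ hB) (Preorder.measurable_frestrictLe n)] at h2
  rw [Measure.map_apply (measurable_pi_apply _) hB,
    Measure.restrict_apply (measurable_pi_apply _ hB), Measure.bind_apply hB κ.aemeasurable,
    killedLaw, lintegral_map (κ.measurable_coe hB) (measurable_pi_apply _), hAn, Set.inter_comm]
  exact h2.symm

theorem killedLaw_zero (E : Set X) (x : X) : killedLaw κ E x 0 = Measure.dirac x := by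
  rw [killedLaw, avoidSet_zero, Measure.restrict_univ, chainLaw_map_zero]

/-- Used with `B = Eᶜ` for survival, giving the recursion of the killed law, and with `B = E` for
entrance at time `n + 1`, giving `optT`. -/
theorem map_restrict_avoidSet_inter {E B : Set X} (hE : MeasurableSet E) (hB : MeasurableSet B)
    (x : X) (n : ℕ) :
    ((chainLaw κ x).restrict (avoidSet E n ∩ {ω | ω (n + 1) ∈ B})).map (fun ω => ω (n + 1)) =
      (κ ∘ₘ killedLaw κ E x n).restrict B := by
  rw [← chainLaw_map_succ κ E hE, Measure.restrict_map (measurable_pi_apply _) hB,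
    Measure.restrict_restrict (measurable_pi_apply _ hB), Set.inter_comm]
  rfl

theorem killedLaw_succ {E : Set X} (hE : MeasurableSet E) (x : X) (n : ℕ) :
    killedLaw κ E x (n + 1) = (κ ∘ₘ killedLaw κ E x n).restrict Eᶜ := by
  rw [killedLaw, avoidSet_succ, map_restrict_avoidSet_inter κ hE hE.compl]

theorem killedLaw_univ_le_one (E : Set X) (x : X) (n : ℕ) : killedLaw κ E x n Set.univ ≤ 1 := by
  rw [killedLaw, Measure.map_apply (measurable_pi_apply _) .univ]
  exact (Measure.restrict_apply_le _ _).trans prob_le_one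

theorem integrable_of_bounded {X : Type*} [MeasurableSpace X] {μ : Measure X} [IsFiniteMeasure μ]
    {f : X → ℝ} (hf : Measurable f) {C : ℝ} (hC : ∀ x, |f x| ≤ C) : Integrable f μ :=
  Integrable.of_bound hf.aestronglyMeasurable C (.of_forall hC)

theorem abs_integral_le_of_mass_le_one {X : Type*} [MeasurableSpace X] {μ : Measure X}
    (hμ : μ Set.univ ≤ 1) {f : X → ℝ} {C : ℝ} (h0 : 0 ≤ C) (hC : ∀ x, |f x| ≤ C) :
    |∫ x, f x ∂μ| ≤ C := by
  have : IsFiniteMeasure μ := ⟨hμ.trans_lt ENNReal.one_lt_top⟩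
  have h1 : μ.real Set.univ ≤ 1 := ENNReal.toReal_mono ENNReal.one_ne_top hμ
  exact (norm_integral_le_of_norm_le_const (f := f) (.of_forall hC)).trans (mul_le_of_le_one_right h0 h1)

theorem integral_bind_kernel (μ : Measure X) [IsFiniteMeasure μ] {f : X → ℝ} (hf : Measurable f)
    {C : ℝ} (hC : ∀ x, |f x| ≤ C) : ∫ x, f x ∂(κ ∘ₘ μ) = ∫ x, ∫ y, f y ∂κ x ∂μ := by
  rw [← Measure.snd_compProd, Measure.snd, integral_map measurable_snd.aemeasurable
    hf.aestronglyMeasurable, Measure.integral_compProd]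
  exact integrable_of_bounded (hf.comp measurable_snd) fun x => hC x.2

end Chain

/-! ### One-step equations and discounted series -/

section Renewal

theorem abs_indicator_le {X : Type*} {E : Set X} {f : X → ℝ} {C : ℝ} (hC : ∀ x, |f x| ≤ C) (x : X) :
    |E.indicator f x| ≤ C :=
  (norm_indicator_le_norm_self f x).trans (hC x)

variable {X : Type*} [MeasurableSpace X] (κ : Kernel X X) [IsMarkovKernel κ]

theorem abs_integral_kernel_le {f : X → ℝ} {C : ℝ} (h0 : 0 ≤ C) (hC : ∀ x, |f x| ≤ C) (x : X) :
    |∫ y, f y ∂κ x| ≤ C :=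
  abs_integral_le_of_mass_le_one prob_le_one h0 hC

theorem bind_killedLaw_univ_le_one (E : Set X) (x : X) (n : ℕ) :
    (κ ∘ₘ killedLaw κ E x n) Set.univ ≤ 1 := by
  rw [Measure.bind_apply .univ κ.aemeasurable]
  simpa using killedLaw_univ_le_one κ E x n

theorem summable_pow_mul_of_bounded {γ C : ℝ} (h0 : 0 ≤ γ) (h1 : γ < 1) {a : ℕ → ℝ}
    (ha : ∀ n, |a n| ≤ C) : Summable fun n => γ ^ n * a n := by
  refine Summable.of_norm_bounded ((summable_geometric_of_lt_one h0 h1).mul_right C) fun n => ?_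
  rw [norm_mul, Real.norm_eq_abs, Real.norm_eq_abs, abs_of_nonneg (pow_nonneg h0 n)]
  exact mul_le_mul_of_nonneg_left (ha n) (pow_nonneg h0 n)

/-- The discounted strong Markov property at the entrance time of `E`, for a solution `u` of the
corresponding one-step equation. -/
theorem eq_tsum_of_one_step {E : Set X} (hE : MeasurableSet E) {γ C : ℝ} (h0 : 0 ≤ γ) (h1 : γ < 1)
    (hC : 0 ≤ C) {u r f : X → ℝ} (hu : Measurable u) (hr : Measurable r) (hf : Measurable f)
    (huC : ∀ x, |u x| ≤ C) (hrC : ∀ x, |r x| ≤ C) (hfC : ∀ x, |f x| ≤ C)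
    (h : ∀ y, u y = r y + γ * (∫ z in E, f z ∂κ y + ∫ z in Eᶜ, u z ∂κ y)) (x : X) :
    u x = ∑' n, γ ^ n * ∫ y, r y ∂killedLaw κ E x n +
      ∑' n, γ ^ (n + 1) * ∫ z in E, f z ∂(κ ∘ₘ killedLaw κ E x n) := by
  set μ := killedLaw κ E x with hμ
  have key : ∀ {B : Set X} {g : X → ℝ}, MeasurableSet B → Measurable g → (∀ x, |g x| ≤ C) → ∀ n,
      Integrable (fun y => ∫ z in B, g z ∂κ y) (μ n) ∧
      ∫ y, ∫ z in B, g z ∂κ y ∂μ n = ∫ z in B, g z ∂(κ ∘ₘ μ n) := by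
    intro B g hB hg hgC n
    simp_rw [← integral_indicator hB]
    exact ⟨integrable_of_bounded (measurable_integral_kernel κ (hg.indicator hB))
      (abs_integral_kernel_le κ hC (abs_indicator_le hgC)),
      (integral_bind_kernel κ (μ n) (hg.indicator hB) (abs_indicator_le hgC)).symm⟩
  -- The one-step equation integrated against the killed law: the mass landing in `E` pays `f` and
  -- is lost, the rest is the killed law at time `n + 1`.
  have step : ∀ n, ∫ y, u y ∂μ n = ∫ y, r y ∂μ n +
      γ * (∫ z in E, f z ∂(κ ∘ₘ μ n) + ∫ y, u y ∂μ (n + 1)) := by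
    intro n
    have hE1 := key hE hf hfC n
    have hE2 := key hE.compl hu huC n
    have hi : Integrable (fun y => γ * (∫ z in E, f z ∂κ y + ∫ z in Eᶜ, u z ∂κ y)) (μ n) :=
      (hE1.1.add hE2.1).const_mul γ
    rw [integral_congr_ae (.of_forall h), integral_add (integrable_of_bounded hr hrC) hi,
      integral_const_mul, integral_add hE1.1 hE2.1, hE1.2, hE2.2, hμ, killedLaw_succ κ hE]
  have hμ1 : ∀ n, μ n Set.univ ≤ 1 := killedLaw_univ_le_one κ E x
  have hs1 : Summable fun n => γ ^ n * ∫ y, r y ∂μ n :=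
    summable_pow_mul_of_bounded h0 h1 fun n => abs_integral_le_of_mass_le_one (hμ1 n) hC hrC
  have hs2 : Summable fun n => γ ^ (n + 1) * ∫ z in E, f z ∂(κ ∘ₘ μ n) := by
    simp_rw [pow_succ', mul_assoc]
    refine (summable_pow_mul_of_bounded (C := C) h0 h1 fun n => ?_).mul_left γ
    rw [← integral_indicator hE]
    exact abs_integral_le_of_mass_le_one (bind_killedLaw_univ_le_one κ E x n) hC
      (abs_indicator_le hfC)
  have hs3 : Summable fun n => γ ^ n * ∫ y, u y ∂μ n :=
    summable_pow_mul_of_bounded h0 h1 fun n => abs_integral_le_of_mass_le_one (hμ1 n) hC huC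
  have hx : γ ^ 0 * ∫ y, u y ∂μ 0 = u x := by
    rw [hμ, killedLaw_zero, integral_dirac' _ _ hu.stronglyMeasurable, pow_zero, one_mul]
  -- The series of `γ ^ n * ∫ u dμ n` is computed twice, by splitting off its first term `u x` and
  -- by inserting `step` termwise. The same summable tail appears in both and cancels.
  have e := hs3.tsum_eq_zero_add
  rw [hx] at e
  have e2 : ∑' n, γ ^ n * ∫ y, u y ∂μ n = ∑' n, (γ ^ n * ∫ y, r y ∂μ n +
      γ ^ (n + 1) * ∫ z in E, f z ∂(κ ∘ₘ μ n) + γ ^ (n + 1) * ∫ y, u y ∂μ (n + 1)) := by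
    congr 1; ext n; rw [step n]; ring
  rw [(hs1.add hs2).tsum_add ((summable_nat_add_iff 1).2 hs3), hs1.tsum_add hs2] at e2
  linarith

/-- With nothing to avoid, the killed law is the `n`-step law. Its last step is absorbed into the
integrand, so the induction has to let `f` vary. -/
theorem integral_killedLaw_empty {f : X → ℝ} {C : ℝ} (hC : 0 ≤ C) (n : ℕ) (hf : Measurable f)
    (hfC : ∀ x, |f x| ≤ C) (x : X) :
    ∫ y, f y ∂killedLaw κ ∅ x n = (fun (g : X → ℝ) x => ∫ y, g y ∂κ x)^[n] f x := by
  induction n generalizing f with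
  | zero => rw [killedLaw_zero, integral_dirac' _ _ hf.stronglyMeasurable]; rfl
  | succ n ih =>
    rw [killedLaw_succ κ .empty, Set.compl_empty, Measure.restrict_univ,
      integral_bind_kernel κ _ hf hfC, ih (measurable_integral_kernel κ hf)
      (abs_integral_kernel_le κ hC hfC), Function.iterate_succ_apply]

/-- The expected discounted sum of the rewards `r` along the chain `κ`. -/
def chainValue (γ : ℝ) (r : X → ℝ) (x : X) : ℝ :=
  ∫ ω, ∑' t : ℕ, γ ^ t * r (ω t) ∂chainLaw κ x

/-- Fubini turns the trajectory integral into a power series in the transition operator.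
Measurability, the one-step equation and the upper bound are all read off from this series. -/
theorem chainValue_eq_tsum {γ C : ℝ} (h0 : 0 ≤ γ) (h1 : γ < 1) {r : X → ℝ}
    (hr : Measurable r) (hC : 0 ≤ C) (hrC : ∀ x, |r x| ≤ C) (x : X) :
    chainValue κ γ r x = ∑' n, γ ^ n * (fun (g : X → ℝ) x => ∫ y, g y ∂κ x)^[n] r x := by
  have hm : ∀ n, Measurable fun ω : ℕ → X => r (ω n) := fun n => hr.comp (measurable_pi_apply n)
  have h := hasSum_integral_of_summable_integral_norm (μ := chainLaw κ x)
    (F := fun (n : ℕ) (ω : ℕ → X) => γ ^ n * r (ω n))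
    (fun n => (integrable_of_bounded (hm n) fun ω => hrC _).const_mul _) (by
      simp_rw [norm_mul, integral_const_mul, norm_pow, Real.norm_of_nonneg h0]
      refine summable_pow_mul_of_bounded (C := C) h0 h1 fun n => ?_
      exact abs_integral_le_of_mass_le_one prob_le_one hC fun ω => by simpa using hrC _)
  rw [chainValue, ← h.tsum_eq]
  congr 1; ext n
  rw [integral_const_mul, ← integral_killedLaw_empty κ hC n hr hrC, killedLaw,
    integral_map (measurable_pi_apply n).aemeasurable hr.aestronglyMeasurable]
  have : avoidSet (∅ : Set X) n = Set.univ := by ext; simp [avoidSet]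
  rw [this, Measure.restrict_univ]

theorem measurable_bounded_iterate {C : ℝ} (hC : 0 ≤ C) {r : X → ℝ} (hr : Measurable r)
    (hrC : ∀ x, |r x| ≤ C) (n : ℕ) :
    Measurable ((fun (g : X → ℝ) x => ∫ y, g y ∂κ x)^[n] r) ∧
      ∀ x, |(fun (g : X → ℝ) x => ∫ y, g y ∂κ x)^[n] r x| ≤ C := by
  induction n with
  | zero => exact ⟨hr, hrC⟩
  | succ n ih =>
    rw [Function.iterate_succ_apply']
    exact ⟨measurable_integral_kernel κ ih.1, abs_integral_kernel_le κ hC ih.2⟩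

theorem measurable_chainValue {γ C : ℝ} (h0 : 0 ≤ γ) (h1 : γ < 1) {r : X → ℝ}
    (hr : Measurable r) (hC : 0 ≤ C) (hrC : ∀ x, |r x| ≤ C) :
    Measurable (chainValue κ γ r) := by
  rw [funext (chainValue_eq_tsum κ h0 h1 hr hC hrC)]
  exact Measurable.tsum fun n => ((measurable_bounded_iterate κ hC hr hrC n).1.const_mul _)

theorem chainValue_one_step {γ C : ℝ} (h0 : 0 ≤ γ) (h1 : γ < 1) {r : X → ℝ}
    (hr : Measurable r) (hC : 0 ≤ C) (hrC : ∀ x, |r x| ≤ C) (x : X) :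
    chainValue κ γ r x = r x + γ * ∫ y, chainValue κ γ r y ∂κ x := by
  set K := fun (g : X → ℝ) x => ∫ y, g y ∂κ x with hK
  have hb := measurable_bounded_iterate κ hC hr hrC
  have h := hasSum_integral_of_summable_integral_norm (μ := κ x)
    (F := fun (n : ℕ) y => γ ^ n * K^[n] r y)
    (fun n => (integrable_of_bounded (hb n).1 (hb n).2).const_mul _) (by
      simp_rw [norm_mul, integral_const_mul, norm_pow, Real.norm_of_nonneg h0]
      refine summable_pow_mul_of_bounded (C := C) h0 h1 fun n => ?_
      exact abs_integral_le_of_mass_le_one prob_le_one hC fun y => by simpa using (hb n).2 y)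
  have hs : Summable fun n => γ ^ n * K^[n] r x :=
    summable_pow_mul_of_bounded h0 h1 fun n => (hb n).2 x
  have e : ∫ y, chainValue κ γ r y ∂κ x = ∑' n, γ ^ n * K^[n + 1] r x := by
    simp_rw [chainValue_eq_tsum κ h0 h1 hr hC hrC]
    rw [← h.tsum_eq]
    congr 1; ext n
    rw [integral_const_mul, Function.iterate_succ_apply']
  rw [e, chainValue_eq_tsum κ h0 h1 hr hC hrC, hs.tsum_eq_zero_add, ← tsum_mul_left]
  simp only [pow_zero, one_mul, Function.iterate_zero, id, pow_succ', mul_assoc]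

theorem chainValue_nonneg {γ : ℝ} (h0 : 0 ≤ γ) {r : X → ℝ} (hr0 : ∀ x, 0 ≤ r x) (x : X) :
    0 ≤ chainValue κ γ r x :=
  integral_nonneg fun _ => tsum_nonneg fun _ => mul_nonneg (pow_nonneg h0 _) (hr0 _)

theorem tsum_pow_mul_le {γ C : ℝ} (h0 : 0 ≤ γ) (h1 : γ < 1) {a : ℕ → ℝ}
    (ha : ∀ n, |a n| ≤ C) : ∑' n, γ ^ n * a n ≤ C / (1 - γ) := by
  rw [div_eq_inv_mul, ← tsum_geometric_of_lt_one h0 h1, ← tsum_mul_right]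
  exact (summable_pow_mul_of_bounded h0 h1 ha).tsum_le_tsum
    (fun n => mul_le_mul_of_nonneg_left (le_of_abs_le (ha n)) (pow_nonneg h0 n))
    ((summable_geometric_of_lt_one h0 h1).mul_right C)

theorem chainValue_le {γ C : ℝ} (h0 : 0 ≤ γ) (h1 : γ < 1) {r : X → ℝ}
    (hr : Measurable r) (hC : 0 ≤ C) (hrC : ∀ x, |r x| ≤ C) (x : X) :
    chainValue κ γ r x ≤ C / (1 - γ) := by
  rw [chainValue_eq_tsum κ h0 h1 hr hC hrC]
  exact tsum_pow_mul_le h0 h1 fun n => (measurable_bounded_iterate κ hC hr hrC n).2 x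

end Renewal

/-! ### Rewards and terminal measures of a single option -/

section Options

variable {S A ι : Type*} [MeasurableSpace S] [MeasurableSpace A]

theorem lt_termTime_iff (D : SubgoalRegions S ι) (o : SubgoalTransition S A ι) (ω : ℕ → S) (k : ℕ) :
    (k : ℕ∞) < termTime D o ω ↔ ω ∈ avoidSet (o.exitSet D) k := by
  -- Writing `τ ≤ k` as `τ < k + 1` lets the infimum be tested by a single witness; a trajectory
  -- that never terminates has `τ = ⊤` and needs no separate case.
  rw [← not_le, ← ENat.lt_add_one_iff (ENat.natCast_ne_top k), termTime, sInf_lt_iff]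
  constructor
  · intro h t h1 h2 h3
    exact h ⟨t, ⟨t, rfl, h1, h3⟩, by exact_mod_cast Nat.lt_succ_of_le h2⟩
  · rintro h ⟨_, ⟨t, rfl, h1, h3⟩, h2⟩
    exact h t h1 (Nat.lt_succ_iff.1 (by exact_mod_cast h2)) h3

theorem termTime_eq_succ_iff (D : SubgoalRegions S ι) (o : SubgoalTransition S A ι) (ω : ℕ → S)
    (k : ℕ) : termTime D o ω = ((k + 1 : ℕ) : ℕ∞) ↔
      ω ∈ avoidSet (o.exitSet D) k ∩ {ω | ω (k + 1) ∈ o.exitSet D} := by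
  have h1 := lt_termTime_iff D o ω k
  have h2 := lt_termTime_iff D o ω (k + 1)
  have h3 : termTime D o ω = ((k + 1 : ℕ) : ℕ∞) ↔
      (k : ℕ∞) < termTime D o ω ∧ ¬ ((k + 1 : ℕ) : ℕ∞) < termTime D o ω := by
    rw [not_lt, le_antisymm_iff, and_comm, Nat.cast_succ,
      ← ENat.add_one_le_iff (ENat.natCast_ne_top k)]
  rw [h3, h1, h2, avoidSet_succ]
  simp only [Set.mem_inter_iff, Set.mem_ofPred_eq, Set.mem_compl_iff]
  tauto

variable (M : MDP S A) (D : SubgoalRegions S ι) (s : S) (o : SubgoalTransition S A ι)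

instance : IsProbabilityMeasure (optionLaw M o s) := by unfold optionLaw; infer_instance

theorem measurable_reward : Measurable fun s => M.R s (o.policy s) :=
  M.measurable_R.comp (measurable_id.prodMk o.measurable_policy)

theorem measurable_runReward (O : Finset (SubgoalTransition S A ι)) :
    Measurable fun p : S × O => M.R p.1 (p.2.1.policy p.1) :=
  measurable_of_option fun o => measurable_reward M o.1

theorem abs_reward_le (s : S) (a : A) : |M.R s a| ≤ 1 := by
  rw [abs_of_nonneg (M.R_nonneg s a)]; exact M.R_le_one s a

theorem optR_eq_tsum [Countable ι] : optR M D s o =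
    ∑' k, M.γ ^ k * ∫ y, M.R y (o.policy y) ∂killedLaw (policyKernel M o) (o.exitSet D) s k := by
  have hE := measurableSet_avoidSet (o.measurableSet_exitSet D)
  have hr := measurable_reward M o
  have hm : ∀ k : ℕ, Measurable fun ω : ℕ → S => M.R (ω k) (o.policy (ω k)) :=
    fun k => hr.comp (measurable_pi_apply k)
  have hF : ∀ (k : ℕ) (ω : ℕ → S), (open Classical in
      if (k : ℕ∞) < termTime D o ω then M.γ ^ k * M.R (ω k) (o.policy (ω k)) else 0) =
      M.γ ^ k * (avoidSet (o.exitSet D) k).indicator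
        (fun ω => M.R (ω k) (o.policy (ω k))) ω := by
    intro k ω
    by_cases h : (k : ℕ∞) < termTime D o ω
    · rw [if_pos h, Set.indicator_of_mem ((lt_termTime_iff D o ω k).1 h)]
    · rw [if_neg h, Set.indicator_of_notMem (mt (lt_termTime_iff D o ω k).2 h), mul_zero]
  have h := hasSum_integral_of_summable_integral_norm (μ := optionLaw M o s)
    (F := fun k ω => M.γ ^ k * (avoidSet (o.exitSet D) k).indicator
        (fun ω : ℕ → S => M.R (ω k) (o.policy (ω k))) ω)
    (fun k => (integrable_of_bounded ((hm k).indicator (hE k))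
      (abs_indicator_le fun ω => abs_reward_le M _ _)).const_mul _) (by
      simp_rw [norm_mul, integral_const_mul, norm_pow, Real.norm_of_nonneg M.γ_nonneg]
      refine summable_pow_mul_of_bounded (C := 1) M.γ_nonneg M.γ_lt_one fun k => ?_
      refine abs_integral_le_of_mass_le_one prob_le_one zero_le_one fun ω => ?_
      simpa using abs_indicator_le (fun ω : ℕ → S => abs_reward_le M (ω k) (o.policy (ω k))) ω)
  rw [optR]
  simp_rw [hF]
  rw [← h.tsum_eq]
  congr 1; ext k
  rw [integral_const_mul, integral_indicator (hE k), killedLaw,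
    integral_map (measurable_pi_apply k).aemeasurable hr.aestronglyMeasurable, optionLaw]

theorem optR_nonneg : 0 ≤ optR M D s o := by
  refine integral_nonneg fun ω => tsum_nonneg fun k => ?_
  split_ifs
  · exact mul_nonneg (pow_nonneg M.γ_nonneg _) (M.R_nonneg _ _)
  · exact le_rfl

theorem boundR_inf_le {i : ι} {s : S} (hs : s ∈ D.region i) (o : SubgoalTransition S A ι) :
    boundR M D .inf i o ≤ optR M D s o :=
  ciInf_le (f := fun s : D.region i => optR M D s o)
    ⟨0, by rintro _ ⟨s, rfl⟩; exact optR_nonneg M D s o⟩ ⟨s, hs⟩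

theorem boundR_inf_nonneg (i : ι) (o : SubgoalTransition S A ι) : 0 ≤ boundR M D .inf i o :=
  Real.iInf_nonneg fun s => optR_nonneg M D s o

/-- Uniformity in `s` matters: it makes `R̃_sup` a genuine supremum, whereas a real supremum over an
unbounded family would default to `0`. -/
theorem optR_le [Countable ι] : optR M D s o ≤ 1 / (1 - M.γ) := by
  rw [optR_eq_tsum]
  exact tsum_pow_mul_le M.γ_nonneg M.γ_lt_one fun k => abs_integral_le_of_mass_le_one
    (killedLaw_univ_le_one _ _ _ _) zero_le_one fun y => abs_reward_le M _ _

theorem optT_eq_sum [Countable ι] : optT M D s o =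
    Measure.sum fun t : ℕ => ENNReal.ofReal (M.γ ^ (t + 1)) •
      (policyKernel M o ∘ₘ killedLaw (policyKernel M o) (o.exitSet D) s t).restrict
        (o.exitSet D) := by
  have hE := o.measurableSet_exitSet D
  rw [optT]
  congr 1; ext1 t
  rw [← map_restrict_avoidSet_inter (policyKernel M o) hE hE, optionLaw]
  have : {ω : ℕ → S | termTime D o ω = ((t + 1 : ℕ) : ℕ∞)} =
      avoidSet (o.exitSet D) t ∩ {ω | ω (t + 1) ∈ o.exitSet D} :=
    Set.ext fun ω => termTime_eq_succ_iff D o ω t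
  rw [this]

theorem optT_univ_le [Countable ι] : optT M D s o Set.univ ≤ ENNReal.ofReal M.γ := by
  have hE := o.measurableSet_exitSet D
  set κ := policyKernel M o
  set E := o.exitSet D
  rw [optT_eq_sum, Measure.sum_apply _ .univ]
  -- Conservation of mass: the probabilities of terminating at the times `1, …, n` and of surviving
  -- past `n` sum to one. The weights `γ ^ (t + 1)` are at most `γ`, whence the factor `γ` in the
  -- bound.
  have hsum : ∀ n, ∑ t ∈ Finset.range n, (κ ∘ₘ killedLaw κ E s t) E +
      killedLaw κ E s n Set.univ = 1 := by
    intro n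
    induction n with
    | zero => simp [killedLaw_zero]
    | succ n ih =>
      rw [← ih, Finset.sum_range_succ, add_assoc, killedLaw_succ κ hE,
        Measure.restrict_apply_univ, measure_add_measure_compl hE,
        Measure.bind_apply .univ κ.aemeasurable]
      simp
  calc ∑' t : ℕ, (ENNReal.ofReal (M.γ ^ (t + 1)) •
        (κ ∘ₘ killedLaw κ E s t).restrict E) Set.univ
      ≤ ∑' t : ℕ, ENNReal.ofReal M.γ * (κ ∘ₘ killedLaw κ E s t) E := by
        refine ENNReal.tsum_le_tsum fun t => ?_
        rw [Measure.smul_apply, smul_eq_mul, Measure.restrict_apply_univ]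
        gcongr
        exact pow_le_of_le_one M.γ_nonneg M.γ_lt_one.le (Nat.succ_ne_zero t)
    _ = ENNReal.ofReal M.γ * ∑' t : ℕ, (κ ∘ₘ killedLaw κ E s t) E := ENNReal.tsum_mul_left
    _ ≤ ENNReal.ofReal M.γ * 1 := by
        gcongr
        exact ENNReal.tsum_le_of_sum_range_le fun n => (hsum n) ▸ le_self_add
    _ = _ := mul_one _

instance [Countable ι] : IsFiniteMeasure (optT M D s o) :=
  ⟨(optT_univ_le M D s o).trans_lt ENNReal.ofReal_lt_top⟩

theorem ae_optT_mem_union [Countable ι] : ∀ᵐ s' ∂optT M D s o, ∃ j, s' ∈ D.region j := by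
  rw [optT_eq_sum, Measure.ae_sum_iff]
  intro t
  refine Measure.ae_smul_measure ?_ _
  filter_upwards [ae_restrict_mem (o.measurableSet_exitSet D)] with s' hs'
  exact Set.mem_iUnion.1 hs'.1

theorem integral_optT_eq_tsum [Countable ι] {f : S → ℝ} (hf : Measurable f) {C : ℝ}
    (hC : ∀ x, |f x| ≤ C) : ∫ x, f x ∂optT M D s o =
      ∑' t : ℕ, M.γ ^ (t + 1) * ∫ x in o.exitSet D, f x
        ∂(policyKernel M o ∘ₘ killedLaw (policyKernel M o) (o.exitSet D) s t) := by
  have hi : Integrable f (optT M D s o) := integrable_of_bounded hf hC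
  rw [optT_eq_sum] at hi ⊢
  rw [← (hasSum_integral_measure hi).tsum_eq]
  congr 1; ext t
  rw [integral_smul_measure, ENNReal.toReal_ofReal (pow_nonneg M.γ_nonneg _), smul_eq_mul]

theorem abstractT_eq [Countable ι] (j : ι) :
    abstractT M D s o j = (optT M D s o).real (D.region j) := by
  have hj := D.measurable j
  rw [Measure.real, optT, Measure.sum_apply _ hj, ENNReal.tsum_toReal_eq]
  · rw [abstractT]
    congr 1; ext t
    rw [Measure.smul_apply, smul_eq_mul, ENNReal.toReal_mul,
      ENNReal.toReal_ofReal (pow_nonneg M.γ_nonneg _), Measure.map_apply (measurable_pi_apply _) hj,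
      Measure.restrict_apply (measurable_pi_apply _ hj), termProb, Measure.real, Set.inter_comm]
    rfl
  · intro t
    rw [Measure.smul_apply, smul_eq_mul]
    exact ENNReal.mul_ne_top ENNReal.ofReal_ne_top (measure_ne_top _ _)

theorem abstractT_nonneg [Countable ι] (j : ι) : 0 ≤ abstractT M D s o j := by
  rw [abstractT_eq]; exact measureReal_nonneg

variable [Fintype ι]

theorem optT_real_univ_le : (optT M D s o).real Set.univ ≤ M.γ :=
  ENNReal.toReal_le_of_le_ofReal M.γ_nonneg (optT_univ_le M D s o)

theorem sum_abstractT_le : ∑ j, abstractT M D s o j ≤ M.γ := by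
  simp_rw [abstractT_eq]
  rw [← measureReal_biUnion_finset (fun i _ j _ h => D.disjoint h) fun j _ => D.measurable j]
  exact (measureReal_mono (Set.subset_univ _)).trans (optT_real_univ_le M D s o)

/-- `optT` lives on the regions, where `f` is dominated by the step function with values `V j` plus
`c`, and its mass is at most `γ`. The term `γ * c` is what makes later error estimates contract. -/
theorem integral_optT_le {f : S → ℝ} (hf : Measurable f) {C : ℝ} (hC : ∀ x, |f x| ≤ C)
    {V : ι → ℝ} {c : ℝ} (hc : 0 ≤ c) (h : ∀ j, ∀ x ∈ D.region j, f x ≤ V j + c) :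
    ∫ x, f x ∂optT M D s o ≤ ∑ j, abstractT M D s o j * V j + M.γ * c := by
  have hi : ∀ j, Integrable ((D.region j).indicator fun _ => V j) (optT M D s o) :=
    fun j => (integrable_const _).indicator (D.measurable j)
  have hi2 : Integrable (fun x => ∑ j, (D.region j).indicator (fun _ => V j) x) (optT M D s o) :=
    integrable_finsetSum _ fun j _ => hi j
  calc ∫ x, f x ∂optT M D s o
      ≤ ∫ x, (∑ j, (D.region j).indicator (fun _ => V j) x + c) ∂optT M D s o := by
        refine integral_mono_ae (integrable_of_bounded hf hC) (hi2.add (integrable_const c)) ?_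
        filter_upwards [ae_optT_mem_union M D s o] with x ⟨j, hj⟩
        rw [Finset.sum_eq_single j, Set.indicator_of_mem hj]
        · exact h j x hj
        · exact fun k _ hk => Set.indicator_of_notMem
            (fun hx => Set.disjoint_left.1 (D.disjoint hk) hx hj) _
        · simp
    _ = ∑ j, abstractT M D s o j * V j + (optT M D s o).real Set.univ * c := by
        rw [integral_add hi2 (integrable_const c), integral_finsetSum _ fun j _ => hi j]
        simp [integral_indicator_const, D.measurable, abstractT_eq]
    _ ≤ _ := by gcongr; exact optT_real_univ_le M D s o

end Options

/-! ### The Bellman equation of an option policy -/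

section Induced

variable {S A ι : Type*} [MeasurableSpace S] [MeasurableSpace A] [Countable ι]
  (M : MDP S A) {D : SubgoalRegions S ι} {O : Finset (SubgoalTransition S A ι)}
  (ρ : OptionPolicy D O)

/-- The expected discounted reward from a state in which an option is already in use. -/
def runValue (p : S × O) : ℝ :=
  chainValue (inducedKernel M ρ) M.γ (fun p => M.R p.1 (p.2.1.policy p.1)) p

theorem value_eq_runValue (s : S) : value M ρ s = runValue M ρ (s, ρ.choose s) := rfl

theorem measurable_runValue : Measurable (runValue M ρ) :=
  measurable_chainValue _ M.γ_nonneg M.γ_lt_one (measurable_runReward M O) zero_le_one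
    fun _ => abs_reward_le M _ _

theorem runValue_nonneg (p : S × O) : 0 ≤ runValue M ρ p :=
  chainValue_nonneg _ M.γ_nonneg (fun _ => M.R_nonneg _ _) p

theorem runValue_le (p : S × O) : runValue M ρ p ≤ 1 / (1 - M.γ) :=
  chainValue_le _ M.γ_nonneg M.γ_lt_one (measurable_runReward M O) zero_le_one
    (fun _ => abs_reward_le M _ _) p

theorem abs_runValue_le (p : S × O) : |runValue M ρ p| ≤ 1 / (1 - M.γ) := by
  rw [abs_of_nonneg (runValue_nonneg M ρ p)]; exact runValue_le M ρ p

theorem measurable_value : Measurable (value M ρ) :=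
  (measurable_runValue M ρ).comp (measurable_id.prodMk ρ.measurable_choose)

theorem abs_value_le (s : S) : |value M ρ s| ≤ 1 / (1 - M.γ) := abs_runValue_le M ρ _

/-- The next state is split according to whether it ends the option: if so, the pair restarts with
the choice of `ρ` and the continuation is `value`; otherwise `o` stays in use. -/
theorem runValue_one_step (o : O) (s : S) :
    runValue M ρ (s, o) = M.R s (o.1.policy s) +
      M.γ * (∫ z in o.1.exitSet D, value M ρ z ∂policyKernel M o.1 s +
        ∫ z in (o.1.exitSet D)ᶜ, runValue M ρ (z, o) ∂policyKernel M o.1 s) := by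
  have hE := o.1.measurableSet_exitSet D
  have hu := measurable_runValue M ρ
  have h := chainValue_one_step (inducedKernel M ρ) M.γ_nonneg M.γ_lt_one
    (measurable_runReward M O) zero_le_one (fun _ => abs_reward_le M _ _) (s, o)
  have e : ∫ y, runValue M ρ y ∂inducedKernel M ρ (s, o) =
      ∫ z, runValue M ρ (ρ.update ((s, o), z)) ∂policyKernel M o.1 s := by
    rw [inducedKernel, Kernel.map_apply _ ρ.measurable_update,
      integral_map ρ.measurable_update.aemeasurable hu.aestronglyMeasurable,
      Kernel.prod_apply, Kernel.id_apply, Measure.dirac_prod]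
    exact integral_map measurable_prodMk_left.aemeasurable
      (hu.comp ρ.measurable_update).aestronglyMeasurable
  have hi : Integrable (fun z => runValue M ρ (ρ.update ((s, o), z))) (policyKernel M o.1 s) :=
    integrable_of_bounded (hu.comp (ρ.measurable_update.comp measurable_prodMk_left))
      fun _ => abs_runValue_le M ρ _
  refine h.trans ?_
  change M.R s (o.1.policy s) + M.γ * ∫ y, runValue M ρ y ∂inducedKernel M ρ (s, o) = _
  rw [e, ← integral_add_compl hE hi]
  congr 3
  · refine setIntegral_congr_fun hE fun z hz => ?_
    simp only [OptionPolicy.update, if_pos hz, value_eq_runValue]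
  · refine setIntegral_congr_fun hE.compl fun z hz => ?_
    simp only [OptionPolicy.update, if_neg hz]

/-- The Bellman equation of an option policy. -/
theorem value_eq_concreteQ (s : S) :
    value M ρ s = concreteQ M D (value M ρ) s (ρ.choose s).1 := by
  -- A single constant `1 / (1 - γ)` then bounds both values and the reward, as
  -- `eq_tsum_of_one_step` demands.
  have h1 : 1 ≤ 1 / (1 - M.γ) := by
    rw [le_div_iff₀ (sub_pos.2 M.γ_lt_one)]; linarith [M.γ_nonneg]
  rw [concreteQ, optR_eq_tsum, integral_optT_eq_tsum M D s _ (measurable_value M ρ)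
    (abs_value_le M ρ), value_eq_runValue]
  exact eq_tsum_of_one_step (policyKernel M (ρ.choose s).1)
    ((ρ.choose s).1.measurableSet_exitSet D) M.γ_nonneg M.γ_lt_one (zero_le_one.trans h1)
    ((measurable_runValue M ρ).comp measurable_prodMk_right)
    (measurable_reward M _) (measurable_value M ρ) (fun _ => abs_runValue_le M ρ _)
    (fun _ => (abs_reward_le M _ _).trans h1) (abs_value_le M ρ)
    (runValue_one_step M ρ (ρ.choose s)) s

end Induced

/-! ### Abstract bounds, contraction, and comparison of the lower fixed point with true values -/

section Abstract

variable {S A ι : Type*} [MeasurableSpace S] [MeasurableSpace A] [Fintype ι]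
  (M : MDP S A) (D : SubgoalRegions S ι) (O : Finset (SubgoalTransition S A ι))

theorem abstractT_mem_Icc (s : S) (o : SubgoalTransition S A ι) (j : ι) :
    abstractT M D s o j ∈ Set.Icc 0 1 :=
  ⟨abstractT_nonneg M D s o j, (Finset.single_le_sum (fun k _ => abstractT_nonneg M D s o k)
    (Finset.mem_univ j)).trans ((sum_abstractT_le M D s o).trans M.γ_lt_one.le)⟩

theorem boundT_inf_le {i : ι} {s : S} (hs : s ∈ D.region i) (o : SubgoalTransition S A ι) (j : ι) :
    boundT M D .inf i o j ≤ abstractT M D s o j :=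
  ciInf_le (f := fun s : D.region i => abstractT M D s o j)
    ⟨0, by rintro _ ⟨s, rfl⟩; exact (abstractT_mem_Icc M D s o j).1⟩ ⟨s, hs⟩

theorem le_boundT_sup {i : ι} {s : S} (hs : s ∈ D.region i) (o : SubgoalTransition S A ι) (j : ι) :
    abstractT M D s o j ≤ boundT M D .sup i o j :=
  le_ciSup (f := fun s : D.region i => abstractT M D s o j)
    ⟨1, by rintro _ ⟨s, rfl⟩; exact (abstractT_mem_Icc M D s o j).2⟩ ⟨s, hs⟩

theorem le_boundR_sup {i : ι} {s : S} (hs : s ∈ D.region i) (o : SubgoalTransition S A ι) :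
    optR M D s o ≤ boundR M D .sup i o :=
  le_ciSup (f := fun s : D.region i => optR M D s o)
    ⟨_, by rintro _ ⟨s, rfl⟩; exact optR_le M D s o⟩ ⟨s, hs⟩

theorem boundT_nonneg (z : BoundKind) (i : ι) (o : SubgoalTransition S A ι) (j : ι) :
    0 ≤ boundT M D z i o j := by
  cases z
  · exact Real.iInf_nonneg fun s => abstractT_nonneg M D s o j
  · exact Real.iSup_nonneg fun s => abstractT_nonneg M D s o j

theorem boundT_sup_sub_inf_le {i : ι} {o : SubgoalTransition S A ι} (ho : o ∈ O)
    (hi : o.source = i) (j : ι) :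
    boundT M D .sup i o j - boundT M D .inf i o j ≤ epsT M D O :=
  le_ciSup (f := fun p : (Σ i : ι, Available O i) × ι =>
    boundT M D .sup p.1.1 p.1.2.1.1 p.2 - boundT M D .inf p.1.1 p.1.2.1.1 p.2)
    (Set.finite_range _).bddAbove (⟨i, ⟨o, ho⟩, hi⟩, j)

theorem boundR_sup_sub_inf_le {i : ι} {o : SubgoalTransition S A ι} (ho : o ∈ O)
    (hi : o.source = i) :
    boundR M D .sup i o - boundR M D .inf i o ≤ epsR M D O :=
  le_ciSup (f := fun p : Σ i : ι, Available O i =>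
    boundR M D .sup p.1 p.2.1.1 - boundR M D .inf p.1 p.2.1.1)
    (Set.finite_range _).bddAbove ⟨i, ⟨o, ho⟩, hi⟩

theorem epsT_nonneg : 0 ≤ epsT M D O :=
  Real.iSup_nonneg fun p => by
    obtain ⟨s, hs⟩ := D.nonempty p.1.1
    exact sub_nonneg.2 ((boundT_inf_le M D hs _ _).trans (le_boundT_sup M D hs _ _))

theorem epsR_nonneg : 0 ≤ epsR M D O :=
  Real.iSup_nonneg fun p => by
    obtain ⟨s, hs⟩ := D.nonempty p.1
    exact sub_nonneg.2 ((boundR_inf_le M D hs _).trans (le_boundR_sup M D hs _))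

theorem sum_boundT_inf_le (i : ι) (o : SubgoalTransition S A ι) :
    ∑ j, boundT M D .inf i o j ≤ M.γ := by
  obtain ⟨s, hs⟩ := D.nonempty i
  exact (Finset.sum_le_sum fun j _ => boundT_inf_le M D hs o j).trans (sum_abstractT_le M D s o)

/-- The suprema for different `j` may be attained at different states, so their sum need not be
bounded by `γ`; comparison with the infima costs one `ε_T` per region. -/
theorem sum_boundT_le (z : BoundKind) {i : ι} {o : SubgoalTransition S A ι} (ho : o ∈ O)
    (hi : o.source = i) :
    ∑ j, boundT M D z i o j ≤ M.γ + Fintype.card ι * epsT M D O := by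
  have h : ∀ j, boundT M D z i o j ≤ boundT M D .inf i o j + epsT M D O := by
    intro j
    cases z
    · exact le_add_of_nonneg_right (epsT_nonneg M D O)
    · linarith [boundT_sup_sub_inf_le M D O ho hi j]
  calc ∑ j, boundT M D z i o j ≤ ∑ j, (boundT M D .inf i o j + epsT M D O) :=
        Finset.sum_le_sum fun j _ => h j
    _ = ∑ j, boundT M D .inf i o j + Fintype.card ι * epsT M D O := by
        rw [Finset.sum_add_distrib, Finset.sum_const, nsmul_eq_mul, Finset.card_univ]
    _ ≤ _ := by linarith [sum_boundT_inf_le M D i o]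

variable {O}

theorem abstractQ_le_abstractBellman (z : BoundKind) (V : ι → ℝ) {i : ι}
    {o : SubgoalTransition S A ι} (ho : o ∈ O) (hi : o.source = i) :
    abstractQ M D z V i o ≤ abstractBellman M D O z V i :=
  le_ciSup (f := fun o : Available O i => abstractQ M D z V i o.1.1)
    (Set.finite_range _).bddAbove ⟨⟨o, ho⟩, hi⟩

theorem abstractBellman_sub_le (hO : ∀ i, ∃ o ∈ O, o.source = i) (z : BoundKind) (V W : ι → ℝ)
    (i : ι) : abstractBellman M D O z V i - abstractBellman M D O z W i ≤
      (M.γ + Fintype.card ι * epsT M D O) * ‖V - W‖ := by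
  obtain ⟨o', ho', hi'⟩ := hO i
  have : Nonempty (Available O i) := ⟨⟨⟨o', ho'⟩, hi'⟩⟩
  rw [sub_le_iff_le_add]
  refine ciSup_le fun ⟨⟨o, ho⟩, hi⟩ => ?_
  have h1 := abstractQ_le_abstractBellman M D z W ho hi
  have h2 : abstractQ M D z V i o - abstractQ M D z W i o ≤
      (∑ j, boundT M D z i o j) * ‖V - W‖ := by
    rw [abstractQ, abstractQ, add_sub_add_left_eq_sub, ← Finset.sum_sub_distrib, Finset.sum_mul]
    refine Finset.sum_le_sum fun j _ => ?_
    rw [← mul_sub]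
    exact mul_le_mul_of_nonneg_left ((le_abs_self _).trans (norm_le_pi_norm (V - W) j))
      (boundT_nonneg M D z i o j)
  have h3 := mul_le_mul_of_nonneg_right (sum_boundT_le M D O z ho hi) (norm_nonneg (V - W))
  dsimp only
  linarith

theorem norm_abstractBellman_sub_le (hO : ∀ i, ∃ o ∈ O, o.source = i) (z : BoundKind)
    (V W : ι → ℝ) : ‖abstractBellman M D O z V - abstractBellman M D O z W‖ ≤
      (M.γ + Fintype.card ι * epsT M D O) * ‖V - W‖ := by
  have h0 : 0 ≤ M.γ + Fintype.card ι * epsT M D O :=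
    add_nonneg M.γ_nonneg (mul_nonneg (Nat.cast_nonneg _) (epsT_nonneg M D O))
  refine (pi_norm_le_iff_of_nonneg (mul_nonneg h0 (norm_nonneg _))).2 fun i => ?_
  refine abs_le'.2 ⟨abstractBellman_sub_le M D hO z V W i, ?_⟩
  rw [Pi.sub_apply, neg_sub, norm_sub_rev]
  exact abstractBellman_sub_le M D hO z W V i

theorem exists_unique_limit_of_norm_sub_le {E : Type*} [NormedAddCommGroup E] [CompleteSpace E]
    {F : E → E} {K : ℝ} (h0 : 0 ≤ K) (h1 : K < 1) (hF : ∀ V W, ‖F V - F W‖ ≤ K * ‖V - W‖) :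
    ∃ Vz, F Vz = Vz ∧ (∀ V, F V = V → V = Vz) ∧
      ∀ V₀, Tendsto (fun n => F^[n] V₀) atTop (𝓝 Vz) := by
  have h : ContractingWith ⟨K, h0⟩ F :=
    ⟨h1, LipschitzWith.of_dist_le_mul fun V W => by
      rw [dist_eq_norm, dist_eq_norm]; exact hF V W⟩
  exact ⟨h.fixedPoint F, h.fixedPoint_isFixedPt, fun V hV => h.fixedPoint_unique hV,
    h.tendsto_iterate_fixedPoint⟩

/-- The least nonnegative upper bound `c` of `h` may itself be fed to `step`, so `c ≤ e + γ * c`.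
Boundedness ensures that `c` exists. -/
theorem le_div_of_bounded_of_step {X : Type*} {h : X → ℝ} (hb : BddAbove (Set.range h))
    {γ e : ℝ} (hγ : 0 ≤ γ) (h1 : γ < 1) (he : 0 ≤ e)
    (step : ∀ c, 0 ≤ c → (∀ x, h x ≤ c) → ∀ x, h x ≤ e + γ * c) (x : X) : h x ≤ e / (1 - γ) := by
  have : Nonempty X := ⟨x⟩
  set c := max 0 (⨆ x, h x) with hc
  have hx : ∀ x, h x ≤ c := fun x => (le_ciSup hb x).trans (le_max_right _ _)
  have h0 : 0 ≤ c := le_max_left _ _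
  have hcc : c ≤ e + γ * c :=
    max_le (add_nonneg he (mul_nonneg hγ h0)) (ciSup_le (step c h0 hx))
  refine (hx x).trans ?_
  rw [le_div_iff₀ (sub_pos.2 h1)]
  linarith

/-- Rewards are nonnegative, so a bound `-c ≤ V` improves to `-γ * c ≤ V`. The sign is needed to
multiply inequalities between transition weights by `V j`. -/
theorem nonneg_of_fixed {V : ι → ℝ}
    (hV : abstractBellman M D O .inf V = V) (hO : ∀ i, ∃ o ∈ O, o.source = i) (i : ι) : 0 ≤ V i := by
  have := le_div_of_bounded_of_step (h := fun i => -V i) (Set.finite_range _).bddAbove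
    M.γ_nonneg M.γ_lt_one le_rfl (fun c hc hV' i => by
      obtain ⟨o, ho, hi⟩ := hO i
      have h1 := abstractQ_le_abstractBellman M D .inf V ho hi
      rw [hV, abstractQ] at h1
      have h2 : ∑ j, boundT M D .inf i o j * (-c) ≤ ∑ j, boundT M D .inf i o j * V j :=
        Finset.sum_le_sum fun j _ => mul_le_mul_of_nonneg_left (by linarith [hV' j])
          (boundT_nonneg M D .inf i o j)
      rw [← Finset.sum_mul] at h2
      have h3 := mul_le_mul_of_nonneg_right (sum_boundT_inf_le M D i o) hc
      linarith [boundR_inf_nonneg M D i o]) i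
  rw [zero_div] at this
  linarith

theorem fixed_le_value {V : ι → ℝ}
    (hV : abstractBellman M D O .inf V = V) (hO : ∀ i, ∃ o ∈ O, o.source = i) (ρ : OptionPolicy D O)
    (hρ : ∀ i, ∀ s ∈ D.region i, ∀ o ∈ O, o.source = i →
      abstractQ M D .inf V i o ≤ abstractQ M D .inf V i (ρ.choose s).1)
    {i : ι} {s : S} (hs : s ∈ D.region i) : V i ≤ value M ρ s := by
  have h0 := nonneg_of_fixed M D hV hO
  -- The index set consists of states paired with their region, since `V` says nothing about states
  -- elsewhere.
  have := le_div_of_bounded_of_step (X := Σ i, D.region i)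
    (h := fun p => V p.1 - value M ρ p.2) ⟨‖V‖, by
      rintro _ ⟨p, rfl⟩
      have h1 := (le_abs_self _).trans (norm_le_pi_norm V p.1)
      have h2 : 0 ≤ value M ρ p.2 := runValue_nonneg M ρ _
      dsimp only
      linarith⟩
    M.γ_nonneg M.γ_lt_one le_rfl (fun c hc hV' ⟨i, s, hs⟩ => by
      have h1 : V i ≤ abstractQ M D .inf V i (ρ.choose s).1 := by
        obtain ⟨o', ho', hi'⟩ := hO i
        have : Nonempty (Available O i) := ⟨⟨⟨o', ho'⟩, hi'⟩⟩
        conv_lhs => rw [← hV]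
        exact ciSup_le fun o => hρ i s hs o.1.1 o.1.2 o.2
      -- Applied to the negatives, the upper estimate yields the needed lower bound on the integral
      -- of the value.
      have h2 := integral_optT_le M D s (ρ.choose s).1 (f := fun x => -value M ρ x)
        (measurable_value M ρ).neg (C := 1 / (1 - M.γ)) (fun x => by
          rw [abs_neg]; exact abs_value_le M ρ x) (V := fun j => -V j) hc
        fun j x hx => by have := hV' ⟨j, x, hx⟩; dsimp only at this; linarith
      have h3 := value_eq_concreteQ M ρ s
      rw [concreteQ] at h3
      rw [abstractQ] at h1
      simp only [integral_neg, mul_neg, Finset.sum_neg_distrib] at h2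
      have h4 : ∑ j, boundT M D .inf i (ρ.choose s).1 j * V j ≤
          ∑ j, abstractT M D s (ρ.choose s).1 j * V j :=
        Finset.sum_le_sum fun j _ => mul_le_mul_of_nonneg_right (boundT_inf_le M D hs _ j) (h0 j)
      have h5 := boundR_inf_le M D hs (ρ.choose s).1
      dsimp only
      linarith) ⟨i, s, hs⟩
  rw [zero_div] at this
  exact sub_nonpos.1 this

/-- Per option, the reward error is at most `ε_R`, and each region contributes a transition error of
at most `ε_T * b`; discounting sums these errors with factor `1 / (1 - γ)`. -/
theorem value_le_fixed_add {V : ι → ℝ}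
    (hV : abstractBellman M D O .inf V = V) (hO : ∀ i, ∃ o ∈ O, o.source = i)
    {b : ℝ} (hb : ∀ i, V i ≤ b) (hb0 : 0 ≤ b) (ρ : OptionPolicy D O)
    {i : ι} {s : S} (hs : s ∈ D.region i) :
    value M ρ s ≤ V i + (epsR M D O + Fintype.card ι * epsT M D O * b) / (1 - M.γ) := by
  have h0 := nonneg_of_fixed M D hV hO
  have := le_div_of_bounded_of_step (X := Σ i, D.region i)
    (h := fun p => value M ρ p.2 - V p.1) ⟨1 / (1 - M.γ), by
      rintro _ ⟨p, rfl⟩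
      have h1 := (le_abs_self _).trans (abs_value_le M ρ p.2)
      have h2 := h0 p.1
      dsimp only
      linarith⟩
    M.γ_nonneg M.γ_lt_one (e := epsR M D O + Fintype.card ι * epsT M D O * b)
    (add_nonneg (epsR_nonneg M D O)
      (mul_nonneg (mul_nonneg (Nat.cast_nonneg _) (epsT_nonneg M D O)) hb0))
    (fun c hc hV' ⟨i, s, hs⟩ => by
      set o := (ρ.choose s).1 with ho
      have hoO : o ∈ O := (ρ.choose s).2
      have hi : o.source = i := ρ.source_choose i s hs
      have h1 := abstractQ_le_abstractBellman M D .inf V hoO hi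
      rw [hV, abstractQ] at h1
      have h2 := integral_optT_le M D s o (measurable_value M ρ) (abs_value_le M ρ) (V := V) hc
        fun j x hx => by have := hV' ⟨j, x, hx⟩; dsimp only at this; linarith
      have h3 := value_eq_concreteQ M ρ s
      rw [concreteQ, ← ho] at h3
      have h4 : ∑ j, abstractT M D s o j * V j ≤
          ∑ j, (boundT M D .inf i o j * V j + epsT M D O * b) := by
        refine Finset.sum_le_sum fun j _ => ?_
        have h5 : abstractT M D s o j ≤ boundT M D .inf i o j + epsT M D O := by
          linarith [boundT_sup_sub_inf_le M D O hoO hi j, le_boundT_sup M D hs o j]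
        have h6 := mul_le_mul_of_nonneg_right h5 (h0 j)
        have h7 := mul_le_mul_of_nonneg_left (hb j) (epsT_nonneg M D O)
        linarith
      rw [Finset.sum_add_distrib, Finset.sum_const, nsmul_eq_mul, Finset.card_univ,
        ← mul_assoc] at h4
      have h5 := le_boundR_sup M D hs o
      have h6 := boundR_sup_sub_inf_le M D O hoO hi
      dsimp only
      linarith) ⟨i, s, hs⟩
  linarith [this]

theorem J_le_J_add {ρ ρ' : OptionPolicy D O} {i₀ : ι} (h₀ : M.η₀ (D.region i₀)ᶜ = 0) {c : ℝ}
    (h : ∀ s ∈ D.region i₀, value M ρ s ≤ value M ρ' s + c) : J M ρ ≤ J M ρ' + c := by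
  have hi : ∀ ρ : OptionPolicy D O, Integrable (value M ρ) M.η₀ := fun ρ =>
    integrable_of_bounded (measurable_value M ρ) (abs_value_le M ρ)
  calc J M ρ ≤ ∫ s, (value M ρ' s + c) ∂M.η₀ := by
        refine integral_mono_ae (hi ρ) ((hi ρ').add (integrable_const c)) ?_
        filter_upwards [compl_mem_ae_iff.2 h₀] with s hs
        exact h s (by simpa using hs)
    _ = J M ρ' + c := by
        rw [integral_add (hi ρ') (integrable_const c)]
        simp [J]

end Abstract

end RAVI

end


/-! ### Convergence and the loss bound -/

theorem theorem1 {S A ι : Type*} [MeasurableSpace S] [MeasurableSpace A] [Fintype ι]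
    (M : RAVI.MDP S A) (D : RAVI.SubgoalRegions S ι)
    (O : Finset (RAVI.SubgoalTransition S A ι))
    -- every region has an option that can be used there
    (hO : ∀ i, ∃ o ∈ O, o.source = i)
    -- the initial state lies in the initial region
    (i₀ : ι) (h₀ : M.η₀ (D.region i₀)ᶜ = 0)
    (hε : Fintype.card ι * RAVI.epsT M D O < 1 - M.γ) :
    (∀ z : RAVI.BoundKind,
      (∀ V W : ι → ℝ, ‖RAVI.abstractBellman M D O z V - RAVI.abstractBellman M D O z W‖ ≤
        (M.γ + Fintype.card ι * RAVI.epsT M D O) * ‖V - W‖) ∧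
      ∃ Vz : ι → ℝ, RAVI.abstractBellman M D O z Vz = Vz ∧
        (∀ V : ι → ℝ, RAVI.abstractBellman M D O z V = V → V = Vz) ∧
        ∀ V₀ : ι → ℝ, Tendsto (fun n => (RAVI.abstractBellman M D O z)^[n] V₀) atTop (𝓝 Vz)) ∧
    ∀ ρc ρs : RAVI.OptionPolicy D O, RAVI.IsConservative M D ρc → RAVI.IsOptimal M D ρs →
      RAVI.J M ρc ≥ RAVI.J M ρs -
        ((1 - M.γ) * RAVI.epsR M D O + Fintype.card ι * RAVI.epsT M D O) /
          ((1 - M.γ) * (1 - (M.γ + Fintype.card ι * RAVI.epsT M D O))) := by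
  have hT : 0 ≤ Fintype.card ι * RAVI.epsT M D O :=
    mul_nonneg (Nat.cast_nonneg _) (RAVI.epsT_nonneg M D O)
  have hR := RAVI.epsR_nonneg M D O
  have hγ : 0 < 1 - M.γ := sub_pos.2 M.γ_lt_one
  refine ⟨fun z => ⟨RAVI.norm_abstractBellman_sub_le M D hO z,
    RAVI.exists_unique_limit_of_norm_sub_le (add_nonneg M.γ_nonneg hT) (by linarith)
      (RAVI.norm_abstractBellman_sub_le M D hO z)⟩, ?_⟩
  -- The bound holds for every option policy `ρs`, so its optimality is not needed.
  rintro ρc ρs ⟨V, hV, hρ⟩ -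
  -- The bound on `V` is inherited from the value of the conservative policy, which avoids the
  -- weaker constant `1 / (1 - (γ + |S̃|ε_T))` of the contraction.
  have hVb : ∀ i, V i ≤ 1 / (1 - M.γ) := fun i => by
    obtain ⟨s, hs⟩ := D.nonempty i
    exact (RAVI.fixed_le_value M D hV hO ρc hρ hs).trans
      ((le_abs_self _).trans (RAVI.abs_value_le M ρc s))
  -- The left side is the stated bound with denominator `(1 - γ)²`; shrinking one factor to `1 - (γ
  -- + |S̃|ε_T)`, still positive by `hε`, only enlarges it.
  have hle : (RAVI.epsR M D O + Fintype.card ι * RAVI.epsT M D O * (1 / (1 - M.γ))) / (1 - M.γ) ≤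
      ((1 - M.γ) * RAVI.epsR M D O + Fintype.card ι * RAVI.epsT M D O) /
        ((1 - M.γ) * (1 - (M.γ + Fintype.card ι * RAVI.epsT M D O))) := by
    have e : RAVI.epsR M D O + Fintype.card ι * RAVI.epsT M D O * (1 / (1 - M.γ)) =
        ((1 - M.γ) * RAVI.epsR M D O + Fintype.card ι * RAVI.epsT M D O) / (1 - M.γ) := by
      field_simp
    rw [e, div_div]
    apply div_le_div_of_nonneg_left
    · positivity
    · exact mul_pos hγ (by linarith)
    · exact mul_le_mul_of_nonneg_left (by linarith) hγ.le
  have hJ := RAVI.J_le_J_add M D (ρ := ρs) (ρ' := ρc) h₀ fun s hs =>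
    (RAVI.value_le_fixed_add M D hV hO hVb (by positivity) ρs hs).trans
      (add_le_add (RAVI.fixed_le_value M D hV hO ρc hρ hs) hle)
  linarith
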